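/- **Setting.** Let $N=\{1,\dots,n\}$ be a set of varieties with $\Omega_j\in\mathbb Z_{\ge 0}$ units of variety $j$. A package is a nonempty subset of $N$; write $\mathcal P$ for the set of packages. A package multiset is a vector $\mathbf k\in\mathbb Z_{\ge0}^{\mathcal P}$; it is feasible, $\mathbf k\in\mathcal K$, if $\sum_{S\ni j}k_S\le\Omega_j$ for all $j$. A price vector $p:\mathcal P\to\mathbb R$ is extended linearly to package multisets by $p(\mathbf k)=\sum_S k_S\,p(S)$ (package-linear pricing). *Buyers.* There are buyers $l\in[L]$. Buyer $l$ consists of $\bar Q^l$ unit-demand agents with values $v^l(S,q)\in\mathbb Z_{\ge 0}$ for $S\in\mathcal P$, where $v^l(S,q)=0$ for $q>\bar Q^l$; let $\bar Q=\max_l\bar Q^l$. The value $V^l(\mathbf k)$ is the maximum of $\sum_q v^l(S_q,q)$ over all ways of giving to each agent $q\in[\bar Q^l]$ at most one package $S_q$ so that each package $S$ is used at most $k_S$ times. Buyer $l$'s demand at $p$ is $D^l(p)=\arg\max_{\mathbf k\in\mathcal K}\big(V^l(\mathbf k)-p(\mathbf k)\big)$. *Seller.* A cost function graph $G$ is a directed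 graph on $\mathcal P$ in which every arc $(T,S)$ satisfies $S\subsetneq T$, and in which there is a directed path from every package $S$ to $\{j\}$ for every $j\in S$. Let $R_0^-(S)$ be the set of packages from which $S$ can be reached (including $S$), and $R^-(S)=R_0^-(S)\setminus\{S\}$. Incremental costs are $\Delta c(S,r)\in\mathbb Z\cup\{\infty\}$, $r\ge1$, nondecreasing in $r$, with $\Delta c(\{j\},r)=\infty$ for $r>\Omega_j$, and with $\Delta c(S,r)=\infty$ for all $S$ once $r$ is large; $\bar R$ is the largest $r$ such that $\Delta c(S,r)<\infty$ for some $S$. The cost of $\mathbf k$ is $C^0(\mathbf k)=\sum_S\sum_{r=1}^{r_S}\Delta c(S,r)$ with $r_S=\sum_{T\in R_0^-(S)}k_T$, and it is assumed that $C^0(\mathbf k)\ge0$ for all $\mathbf k\in\mathcal K$. The seller's supply at $p$ is $D^0(p)=\arg\max_{\mathbf k\in\mathcal K,\,C^0(\mathbf k)<\infty}\big(p(\mathbf k)-C^0(\mathbf k)\big)$. *Equilibrium.* An allocation is a family $\pi=(\pi(l))_{l\in[L]}$ of package multisets with $\sum_l\pi(l)\in\mathcal K$; the remaining items stay with the seller.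 The pair $(p,\pi)$ is a package-linear pricing Walrasian equilibrium if $\pi$ is an allocation, $\sum_{l}\pi(l)\in D^0(p)$, and $\pi(l)\in D^l(p)$ for all $l\in[L]$. *Linear programs.* The characteristic function $\phi^G$ of $G$ is the linear map defined recursively, for $Y_S=\sum_{r\in[\bar R]}y(S,r)$, by $\phi^G_S(y)=Y_S-\sum_{T\in R^-(S)}\phi^G_T(y)$. Thus $\phi^G(y)=\Phi Y$ for a square matrix $\Phi$; put $\psi^G(p)=\Phi^{\mathsf T}p$. With $S\in\mathcal P$, $q\in[\bar Q]$, $l\in[L]$, $r\in[\bar R]$, SWLP is $$\max\ \sum_{S,q,l}v^l(S,q)x(S,q,l)-\sum_{S,r}\Delta c(S,r)y(S,r)$$ subject to $\sum_Sx(S,q,l)\le1$ for all $q,l$; $\sum_{q,l}x(S,q,l)\le\phi^G_S(y)$ for all $S$; $y(S,r)\le1$ and $x(S,q,l),y(S,r)\ge0$, where $y(S,r)=0$ if $\Delta c(S,r)=\infty$ (and $\infty\cdot 0=0$ in the objective). Its dual DSWLP is $$\min\ \sum_{q,l}b(q,l)+\sum_{S,r}d(S,r)$$ subject to $b(q,l)+p(S)\ge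 v^l(S,q)$ for all $S,q,l$; $d(S,r)-\psi^G_S(p)\ge-\Delta c(S,r)$ for all $S,r$ (void if $\Delta c(S,r)=\infty$); and $b,d,p\ge0$. **Proposition.** Let $(x,y)$ be an optimal solution of SWLP that describes an allocation, i.e. $x(S,q,l),y(S,r)\in\{0,1\}$ for all $S,q,l,r$, and let $(b,d,p)$ be any optimal solution of DSWLP. Then the prices $p$ support $(x,y)$ as a package-linear pricing Walrasian equilibrium: with $\pi(l)_S=\sum_qx(S,q,l)$, the pair $(p,\pi)$ is a package-linear pricing Walrasian equilibrium; moreover, the vector $\mathbf k=\phi^G(y)$ encoded by $y$ is a package multiset with $\mathbf k\in D^0(p)$. -/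

import Mathlib

noncomputable section

namespace PackageMarket

open scoped Classical

/-- A package: a nonempty set of the varieties `0, …, n - 1`. -/
abbrev Package (n : ℕ) : Type := {S : Finset (Fin n) // S.Nonempty}

/-- The package consisting of the single variety `j`. -/
def single {n : ℕ} (j : Fin n) : Package n := ⟨{j}, Finset.singleton_nonempty j⟩

/-- A package multiset: `k S` is the multiplicity of the package `S`. -/
abbrev PackageMultiset (n : ℕ) : Type := Package n → ℕ

/-- Unpacking: the number of units of variety `j` contained in the package multiset `k`. -/
def unpack {n : ℕ} (k : PackageMultiset n) (j : Fin n) : ℕ :=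
  ∑ S : Package n, if j ∈ S.1 then k S else 0

/-- The feasible package multisets, when there are `Ω j` units of variety `j`. -/
def feasible {n : ℕ} (Ω : Fin n → ℕ) : Set (PackageMultiset n) :=
  {k | ∀ j, unpack k j ≤ Ω j}

/-- The price of a package multiset under the package-linear pricing function given by `p`. -/
def price {n : ℕ} (p : Package n → ℝ) (k : PackageMultiset n) : ℝ :=
  ∑ S, (k S : ℝ) * p S

/-- A cost function graph: arcs `T → S` go from a package to a strict sub-package, and from every
package there is a directed path to each single variety it contains. -/
structure CostFunctionGraph (n : ℕ) where
  Arc : Package n → Package n → Prop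
  ssubset_of_arc : ∀ T S, Arc T S → S.1 ⊂ T.1
  connected_single : ∀ (S : Package n) (j : Fin n), j ∈ S.1 → Relation.ReflTransGen Arc S (single j)

namespace CostFunctionGraph

variable {n : ℕ} (G : CostFunctionGraph n)

/-- The predecessors of `S`, including `S` itself. -/
def pred₀ (S : Package n) : Finset (Package n) :=
  {T | Relation.ReflTransGen G.Arc T S}

/-- The strict predecessors of `S`. -/
def pred (S : Package n) : Finset (Package n) :=
  {T | Relation.ReflTransGen G.Arc T S ∧ T ≠ S}

theorem subset_of_path {T S : Package n} (h : Relation.ReflTransGen G.Arc T S) : S.1 ⊆ T.1 := by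
  induction h with
  | refl => exact Finset.Subset.refl _
  | tail _ h ih => exact (G.ssubset_of_arc _ _ h).1.trans ih

theorem card_lt_of_mem_pred {T S : Package n} (h : T ∈ G.pred S) : S.1.card < T.1.card := by
  simp only [pred, Finset.mem_filter, Finset.mem_univ, true_and] at h
  refine Finset.card_lt_card ((G.subset_of_path h.1).ssubset_of_ne ?_)
  exact fun e => h.2 (Subtype.ext e.symm)

/-- The number `r_S` of sold packages that are cost-connected to `S`. -/
def load (k : PackageMultiset n) (S : Package n) : ℕ := ∑ T ∈ G.pred₀ S, k T

/-- The cost of a package multiset, given incremental costs `Δc S r` (`r = 1, 2, …`), where the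
value `⊤` stands for an infinite cost. -/
def cost (Δc : Package n → ℕ → WithTop ℤ) (k : PackageMultiset n) : WithTop ℤ :=
  ∑ S : Package n, ∑ r ∈ Finset.Icc 1 (G.load k S), Δc S r

/-- The characteristic function `φ^G`, as a function of the total quantities `Y S` assigned on the
incremental cost functions: `φ_S = Y S - ∑ φ_T`, summed over the strict predecessors `T` of `S`. -/
def phi (Y : Package n → ℝ) (S : Package n) : ℝ :=
  Y S - ∑ T ∈ (G.pred S).attach, phi Y T.1
termination_by n - S.1.card
decreasing_by
  have h₁ := G.card_lt_of_mem_pred T.2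
  have h₂ := card_finset_fin_le T.1.1
  omega

/-- The matrix `Φ` of the linear map `φ^G`. -/
def phiMatrix : Matrix (Package n) (Package n) ℝ :=
  Matrix.of fun S T => G.phi (Pi.single T 1) S

/-- The characteristic function dual `ψ^G(p) = Φᵀ p`. -/
def psi (p : Package n → ℝ) : Package n → ℝ :=
  (phiMatrix G).transpose.mulVec p

end CostFunctionGraph

/-- A market with `n` varieties, one seller and `L` buyers. -/
structure Market (n L : ℕ) where
  /-- The number of units of each variety. -/
  Ω : Fin n → ℕ
  /-- The number of fictitious unit-demand agents of each buyer; they are labelled `1, …, Q l`. -/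
  Q : Fin L → ℕ
  /-- `v l S q` is the value of the package `S` for the `q`-th unit-demand agent of buyer `l`. -/
  v : Fin L → Package n → ℕ → ℕ
  v_eq_zero : ∀ l S q, Q l < q → v l S q = 0
  /-- The cost function graph of the seller. -/
  G : CostFunctionGraph n
  /-- The incremental costs `Δc S r`, for `r = 1, 2, …`. -/
  Δc : Package n → ℕ → WithTop ℤ
  Δc_single : ∀ j r, Ω j < r → Δc (single j) r = ⊤
  Δc_mono : ∀ S r, 1 ≤ r → Δc S r ≤ Δc S (r + 1)
  Δc_finite_steps : ∃ R, ∀ S r, R < r → Δc S r = ⊤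
  cost_nonneg : ∀ k ∈ feasible Ω, 0 ≤ G.cost Δc k

namespace Market

variable {n L : ℕ} (M : Market n L)

/-- The largest number of unit-demand agents of a buyer. -/
def Qbar : ℕ := Finset.univ.sup M.Q

/-- The last step at which some incremental cost is finite. -/
def Rbar : ℕ := sSup {r | ∃ S, M.Δc S r ≠ ⊤}

/-- The labels `1, …, Qbar` of unit-demand agents in the linear programs. -/
abbrev Agent : Type := Finset.Icc 1 M.Qbar

/-- The steps `1, …, Rbar` in the linear programs. -/
abbrev Step : Type := Finset.Icc 1 M.Rbar

/-- The assignments of at most one package to each unit-demand agent of buyer `l` that use each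
package `S` at most `k S` times. -/
def matchings (l : Fin L) (k : PackageMultiset n) :
    Finset (Finset.Icc 1 (M.Q l) → Option (Package n)) :=
  {s | ∀ S, (Finset.univ.filter fun q => s q = some S).card ≤ k S}

/-- The value `V^l(k)` of a package multiset for buyer `l`: the maximal value of a matching. -/
def value (l : Fin L) (k : PackageMultiset n) : ℕ :=
  (M.matchings l k).sup fun s => ∑ q, (s q).elim 0 fun S => M.v l S q

/-- The demand correspondence `D^l(p)` of buyer `l`. -/
def demand (l : Fin L) (p : Package n → ℝ) : Set (PackageMultiset n) :=
  {k | k ∈ feasible M.Ω ∧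
    ∀ k' ∈ feasible M.Ω, (M.value l k' : ℝ) - price p k' ≤ (M.value l k : ℝ) - price p k}

/-- The cost function `C^0` of the seller. -/
def sellerCost (k : PackageMultiset n) : WithTop ℤ := M.G.cost M.Δc k

/-- The utility of the seller, for package multisets of finite cost. -/
def sellerUtility (p : Package n → ℝ) (k : PackageMultiset n) : ℝ :=
  price p k - (((M.sellerCost k).untopD 0 : ℤ) : ℝ)

/-- The supply correspondence `D^0(p)` of the seller. A package multiset of infinite cost has
utility `-∞`, so the maximum runs over the feasible ones of finite cost. -/
def supply (p : Package n → ℝ) : Set (PackageMultiset n) :=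
  {k | (k ∈ feasible M.Ω ∧ M.sellerCost k ≠ ⊤) ∧
    ∀ k' ∈ feasible M.Ω, M.sellerCost k' ≠ ⊤ → M.sellerUtility p k' ≤ M.sellerUtility p k}

/-- `π` assigns package multisets to the buyers within the available supply. The remaining units
`Ω j - unpack (∑ l, π l) j` stay with the seller. -/
def IsAllocation (π : Fin L → PackageMultiset n) : Prop :=
  ∑ l, π l ∈ feasible M.Ω

/-- Package-linear pricing Walrasian equilibrium. -/
def IsWalrasianEquilibrium (p : Package n → ℝ) (π : Fin L → PackageMultiset n) : Prop :=
  M.IsAllocation π ∧ ∑ l, π l ∈ M.supply p ∧ ∀ l, π l ∈ M.demand l p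

/-- The real value of a finite incremental cost. -/
def stepCost (S : Package n) (r : ℕ) : ℝ := (((M.Δc S r).untopD 0 : ℤ) : ℝ)

/-- The value of the characteristic function at an assignment `y` of incremental cost steps. -/
def phiOf (y : Package n → M.Step → ℝ) (S : Package n) : ℝ :=
  M.G.phi (fun T => ∑ r, y T r) S

/-- Feasibility in the linear program SWLP. Steps of infinite cost cannot be used. -/
structure IsPrimalFeasible (x : Package n → M.Agent → Fin L → ℝ)
    (y : Package n → M.Step → ℝ) : Prop where
  agent_le_one : ∀ q l, ∑ S, x S q l ≤ 1
  sold_le_phi : ∀ S, ∑ q, ∑ l, x S q l - M.phiOf y S ≤ 0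
  y_le_one : ∀ S r, y S r ≤ 1
  x_nonneg : ∀ S q l, 0 ≤ x S q l
  y_nonneg : ∀ S r, 0 ≤ y S r
  y_eq_zero : ∀ (S : Package n) (r : M.Step), M.Δc S r = ⊤ → y S r = 0

/-- The objective function of SWLP. -/
def primalObjective (x : Package n → M.Agent → Fin L → ℝ) (y : Package n → M.Step → ℝ) : ℝ :=
  ∑ S, ∑ q : M.Agent, ∑ l, (M.v l S q : ℝ) * x S q l - ∑ S, ∑ r : M.Step, M.stepCost S r * y S r

/-- `(x, y)` is an optimal solution of SWLP. -/
def IsPrimalOptimal (x : Package n → M.Agent → Fin L → ℝ) (y : Package n → M.Step → ℝ) : Prop :=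
  M.IsPrimalFeasible x y ∧
    ∀ x' y', M.IsPrimalFeasible x' y' → M.primalObjective x' y' ≤ M.primalObjective x y

/-- Feasibility in the dual linear program DSWLP. The constraint of a step of infinite cost is
void. -/
structure IsDualFeasible (b : M.Agent → Fin L → ℝ) (d : Package n → M.Step → ℝ)
    (p : Package n → ℝ) : Prop where
  value_le : ∀ (S : Package n) (q : M.Agent) (l : Fin L), (M.v l S q : ℝ) ≤ b q l + p S
  neg_cost_le : ∀ (S : Package n) (r : M.Step), M.Δc S r ≠ ⊤ → -M.stepCost S r ≤ d S r - M.G.psi p S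
  b_nonneg : ∀ q l, 0 ≤ b q l
  d_nonneg : ∀ S r, 0 ≤ d S r
  p_nonneg : ∀ S, 0 ≤ p S

/-- The objective function of DSWLP. -/
def dualObjective (b : M.Agent → Fin L → ℝ) (d : Package n → M.Step → ℝ) : ℝ :=
  ∑ q, ∑ l, b q l + ∑ S, ∑ r, d S r

/-- `(b, d, p)` is an optimal solution of DSWLP. -/
def IsDualOptimal (b : M.Agent → Fin L → ℝ) (d : Package n → M.Step → ℝ)
    (p : Package n → ℝ) : Prop :=
  M.IsDualFeasible b d p ∧
    ∀ b' d' p', M.IsDualFeasible b' d' p' → M.dualObjective b d ≤ M.dualObjective b' d'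

end Market

end PackageMarket

end

/-!
Strong duality makes the optimal dual value `∑ b + ∑ d` equal to the welfare of `(x, y)`. Dual
feasibility bounds the indirect utility of buyer `l` at the prices `p` by `∑ q, b(q, l)`, and that
of the seller by `∑ d`. A 0/1 solution `(x, y)` encodes bundles `π(l)` and a package multiset
`k = φ(y)` with `∑ l, π(l) ≤ k`, whose total value minus cost is at least the welfare of `(x, y)`:
the steps chosen by `y` need not be the first ones, but replacing them by the first ones only lowers
the nondecreasing incremental costs. Since `p ≥ 0`, the payments of the buyers do not exceed the
revenue from `k`, so all the bounds are attained. As `C⁰` is monotone, the same argument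
applies to `∑ l, π(l)` in place of `k`.
-/

namespace LinearProgramming

variable {𝕜 V ι : Type*} [Field 𝕜] [LinearOrder 𝕜] [IsStrictOrderedRing 𝕜]
  [AddCommGroup V] [Module 𝕜 V]

theorem nonneg_of_mem_hull {s : Set (Module.Dual 𝕜 V)} {z : V} (h : ∀ f ∈ s, 0 ≤ f z)
    {g : Module.Dual 𝕜 V} (hg : g ∈ PointedCone.hull 𝕜 s) : 0 ≤ g z := by
  induction hg using Submodule.span_induction with
  | mem f hf => exact h f hf
  | zero => exact le_rfl
  | add f g _ _ hf hg => exact add_nonneg hf hg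
  | smul a f _ hf => exact mul_nonneg a.2 hf

theorem mem_hull_insert_of_transvection {s : Set (Module.Dual 𝕜 V)} {a c : Module.Dual 𝕜 V}
    {z : V} (hs : ∀ f ∈ s, 0 ≤ f z) (haz : a z < 0) (hcz : c z < 0)
    (hc : (LinearMap.transvection a (-(a z)⁻¹ • z)).dualMap c ∈
      PointedCone.hull 𝕜 ((LinearMap.transvection a (-(a z)⁻¹ • z)).dualMap '' s)) :
    c ∈ PointedCone.hull 𝕜 (insert a s) := by
  set π : V →ₗ[𝕜] V := LinearMap.transvection a (-(a z)⁻¹ • z)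
  have hπ (g : Module.Dual 𝕜 V) (y : V) : g (π y) = g y - a y * ((a z)⁻¹ * g z) := by
    simp [π, LinearMap.transvection.apply, sub_eq_add_neg]
  have hmap : (PointedCone.hull 𝕜 s).map π.dualMap = PointedCone.hull 𝕜 (π.dualMap '' s) :=
    Submodule.map_span _ _
  rw [← hmap, PointedCone.mem_map] at hc
  obtain ⟨g, hg, hgc⟩ := hc
  have hcoeff : 0 ≤ (a z)⁻¹ * (c z - g z) :=
    mul_nonneg_of_nonpos_of_nonpos (inv_nonpos.2 haz.le)
      (sub_nonpos.2 (hcz.le.trans (nonneg_of_mem_hull hs hg)))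
  refine Submodule.mem_span_insert.2 ⟨⟨_, hcoeff⟩, g, hg, LinearMap.ext fun y => ?_⟩
  have hy : g (π y) = c (π y) := LinearMap.congr_fun hgc y
  rw [hπ, hπ] at hy
  change c y = (a z)⁻¹ * (c z - g z) * a y + g y
  linear_combination -hy

theorem mem_hull_image_of_forall_nonneg (s : Finset ι) (f : ι → Module.Dual 𝕜 V)
    (c : Module.Dual 𝕜 V) (h : ∀ z, (∀ i ∈ s, 0 ≤ f i z) → 0 ≤ c z) :
    c ∈ PointedCone.hull 𝕜 (f '' s) := by
  classical
  induction s using Finset.induction_on generalizing f c with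
  | empty =>
    have hc : c = 0 := LinearMap.ext fun z =>
      le_antisymm (by simpa using h (-z)) (by simpa using h z)
    simp [hc]
  | insert a s _ ih =>
    rw [Finset.coe_insert, Set.image_insert_eq]
    by_cases hs : ∀ z, (∀ i ∈ s, 0 ≤ f i z) → 0 ≤ c z
    · exact Submodule.span_mono (Set.subset_insert _ _) (ih f c hs)
    push Not at hs
    obtain ⟨z, hz, hcz⟩ := hs
    have haz : f a z < 0 := by
      by_contra! haz
      exact hcz.not_ge (h z (Finset.forall_mem_insert _ _ _ |>.2 ⟨haz, hz⟩))
    -- Project along `z` onto the hyperplane `f a = 0`, where the constraint `f a` is void.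
    refine mem_hull_insert_of_transvection (by simpa using hz) haz hcz ?_
    rw [Set.image_image]
    exact ih _ _ fun y hy => h _ <| Finset.forall_mem_insert _ _ _ |>.2
      ⟨by simp [LinearMap.transvection.apply, haz.ne], hy⟩

theorem exists_nonneg_sum_smul_eq_of_forall_nonneg (s : Finset ι) (f : ι → Module.Dual 𝕜 V)
    (c : Module.Dual 𝕜 V) (h : ∀ z, (∀ i ∈ s, 0 ≤ f i z) → 0 ≤ c z) :
    ∃ w : ι → 𝕜, (∀ i, 0 ≤ w i) ∧ c = ∑ i ∈ s, w i • f i := by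
  obtain ⟨w, hw⟩ := (Submodule.mem_span_image_finset_iff_exists_fun' _).1
    (mem_hull_image_of_forall_nonneg s f c h)
  exact ⟨fun i => w i, fun i => (w i).2, hw.symm⟩

theorem exists_pos_forall_add_mul_le [Finite ι] {a b β : ι → 𝕜} (hle : ∀ i, a i ≤ β i)
    (hactive : ∀ i, a i = β i → b i ≤ 0) : ∃ ε > 0, ∀ i, a i + ε * b i ≤ β i := by
  have hstep (i : ι) : ∃ t : Set.Ioi (0 : 𝕜), ∀ ε ∈ Set.Ioc 0 (t : 𝕜), a i + ε * b i ≤ β i := by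
    rcases (hle i).eq_or_lt with heq | hlt
    · exact ⟨⟨1, one_pos⟩, fun ε hε => by
        linarith [mul_nonpos_of_nonneg_of_nonpos hε.1.le (hactive i heq)]⟩
    · have hb : 0 < |b i| + 1 := by positivity
      refine ⟨⟨(β i - a i) / (|b i| + 1), div_pos (sub_pos.2 hlt) hb⟩, fun ε hε => ?_⟩
      have hε' : ε * (|b i| + 1) ≤ β i - a i := (le_div_iff₀ hb).1 hε.2
      linarith [mul_le_mul_of_nonneg_left (le_abs_self (b i)) hε.1.le, hε.1]
  choose t ht using hstep
  obtain ⟨ε, hε⟩ := Set.finite_range t |>.bddBelow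
  exact ⟨ε, ε.2, fun i => ht i ε ⟨ε.2, hε (Set.mem_range_self i)⟩⟩

theorem exists_lagrange_multipliers [Fintype ι] (f : ι → Module.Dual 𝕜 V) (β : ι → 𝕜)
    (c : Module.Dual 𝕜 V) {z₀ : V} (hz₀ : ∀ i, f i z₀ ≤ β i)
    (hmax : IsMaxOn c {z | ∀ i, f i z ≤ β i} z₀) :
    ∃ w : ι → 𝕜, (∀ i, 0 ≤ w i) ∧ c = ∑ i, w i • f i ∧ ∑ i, w i * β i = c z₀ := by
  classical
  let active : Finset ι := {i | f i z₀ = β i}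
  have hcone (z : V) (hz : ∀ i ∈ active, f i z ≤ 0) : c z ≤ 0 := by
    obtain ⟨ε, hε, hfeas⟩ := exists_pos_forall_add_mul_le hz₀ fun i hi => hz i (by simpa [active])
    have hle : c (z₀ + ε • z) ≤ c z₀ := hmax fun i => by simpa using hfeas i
    rw [map_add, map_smul, smul_eq_mul, add_le_iff_nonpos_right] at hle
    exact nonpos_of_mul_nonpos_right hle hε
  obtain ⟨w, hw, hc⟩ := exists_nonneg_sum_smul_eq_of_forall_nonneg active f c fun z hz => by
    simpa using hcone (-z) (by simpa using hz)
  refine ⟨fun i => if i ∈ active then w i else 0, fun i => ?_, ?_, ?_⟩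
  · dsimp only
    split_ifs
    exacts [hw i, le_rfl]
  · simpa only [ite_smul, zero_smul, Finset.sum_ite_mem, Finset.univ_inter] using hc
  · simp only [hc, LinearMap.sum_apply, LinearMap.smul_apply, smul_eq_mul, ite_mul, zero_mul,
      Finset.sum_ite_mem, Finset.univ_inter]
    exact Finset.sum_congr rfl fun i hi => by rw [(Finset.mem_filter.1 hi).2]

open Matrix in
theorem exists_dual_of_isMaxOn {I J : Type*} [Fintype I] [Fintype J] (A : Matrix I J 𝕜)
    (β : I → 𝕜) (c : J → 𝕜) {z₀ : J → 𝕜} (hz₀ : A *ᵥ z₀ ≤ β ∧ 0 ≤ z₀)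
    (hmax : IsMaxOn (c ⬝ᵥ ·) {z | A *ᵥ z ≤ β ∧ 0 ≤ z} z₀) :
    ∃ w, 0 ≤ w ∧ c ≤ w ᵥ* A ∧ w ⬝ᵥ β = c ⬝ᵥ z₀ := by
  classical
  let f : I ⊕ J → Module.Dual 𝕜 (J → 𝕜) :=
    Sum.elim (fun i => LinearMap.proj i ∘ₗ A.mulVecLin) fun j => -LinearMap.proj j
  have hf (z : J → 𝕜) : (∀ i, f i z ≤ Sum.elim β 0 i) ↔ A *ᵥ z ≤ β ∧ 0 ≤ z := by
    simp [f, Sum.forall, Pi.le_def]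
  obtain ⟨w, hw, hc, hval⟩ := exists_lagrange_multipliers f (Sum.elim β 0) (dotProductEquiv 𝕜 J c)
    ((hf z₀).2 hz₀) fun z hz => hmax ((hf z).1 hz)
  refine ⟨w ∘ Sum.inl, fun i => hw _, fun j => ?_, ?_⟩
  · have hj : c j = ((w ∘ Sum.inl) ᵥ* A) j - w (.inr j) := by
      simpa [f, Fintype.sum_sum_type, vecMul, dotProduct, Pi.single_apply, sub_eq_add_neg] using
        LinearMap.congr_fun hc (Pi.single j 1)
    linarith [hw (.inr j)]
  · simpa [Fintype.sum_sum_type, dotProduct] using hval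

end LinearProgramming

theorem sum_Icc_card_le_sum {α : Type*} [AddCommMonoid α] [PartialOrder α]
    [IsOrderedAddMonoid α] {f : ℕ → α} (hf : MonotoneOn f (Set.Ici 1)) {A : Finset ℕ}
    (hA : ∀ a ∈ A, 1 ≤ a) : ∑ r ∈ Finset.Icc 1 A.card, f r ≤ ∑ a ∈ A, f a := by
  induction A using Finset.induction_on_max with
  | empty => simp
  | insert a s hs ih =>
    have ha : a ∉ s := fun h => (hs a h).false
    have hsub : s ⊆ Finset.Ico 1 a := fun r hr =>
      Finset.mem_Ico.2 ⟨hA r (Finset.mem_insert_of_mem hr), hs r hr⟩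
    have hcard : s.card + 1 ≤ a := by
      have ha₁ := hA a (Finset.mem_insert_self a s)
      have := Finset.card_le_card hsub
      rw [Nat.card_Ico] at this
      omega
    rw [Finset.sum_insert ha, Finset.card_insert_of_notMem ha,
      Finset.sum_Icc_succ_top (Nat.le_add_left 1 _), add_comm (f a)]
    exact add_le_add (ih fun r hr => hA r (Finset.mem_insert_of_mem hr))
      (hf (Nat.le_add_left 1 _) (hA a (Finset.mem_insert_self a s)) hcard)

theorem sum_Icc_add_sum_Icc_le {α : Type*} [AddCommMonoid α] [PartialOrder α]
    [IsOrderedAddMonoid α] {f : ℕ → α} (hf : MonotoneOn f (Set.Ici 1)) (m m' : ℕ) :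
    ∑ r ∈ Finset.Icc 1 m, f r + ∑ r ∈ Finset.Icc 1 m', f r ≤
      ∑ r ∈ Finset.Icc 1 (m + m'), f r := by
  have hIcc (j : ℕ) : Finset.Icc 1 j = Finset.Ioc 0 j := Finset.Icc_add_one_left_eq_Ioc 0 j
  have hshift : ∑ r ∈ Finset.Icc 1 m', f r ≤ ∑ r ∈ Finset.Ioc m (m + m'), f r := by
    simpa using sum_Icc_card_le_sum hf (A := Finset.Ioc m (m + m')) fun a ha =>
      Nat.one_le_of_lt (Finset.mem_Ioc.1 ha).1
  calc _ ≤ ∑ r ∈ Finset.Icc 1 m, f r + ∑ r ∈ Finset.Ioc m (m + m'), f r := by gcongr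
    _ = _ := by rw [hIcc, hIcc, Finset.sum_Ioc_consecutive f (Nat.zero_le m) (by omega)]

theorem sum_comp_inclusion_le {α β : Type*} [AddCommMonoid β] [PartialOrder β]
    [IsOrderedAddMonoid β] {s t : Finset α} (h : s ⊆ t) {f : t → β} (hf : ∀ a, 0 ≤ f a) :
    ∑ a : s, f ⟨a, h a.2⟩ ≤ ∑ a, f a := by
  have hinj : Function.Injective fun a : s => (⟨a, h a.2⟩ : t) := fun a a' e =>
    Subtype.ext (congrArg (fun b : t => b.1) e)
  exact (Finset.sum_map Finset.univ ⟨_, hinj⟩ f).ge.trans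
    (Finset.sum_le_sum_of_subset_of_nonneg (Finset.subset_univ _) fun a _ _ => hf a)

theorem coe_untopD_of_ne_top {α : Type*} {a : WithTop α} {d : α} (ha : a ≠ ⊤) :
    ((a.untopD d : α) : WithTop α) = a := by
  lift a to α using ha
  rfl

theorem exists_option_of_zero_or_one {α R : Type*} [Fintype α] [DecidableEq α] [CommRing R]
    [LinearOrder R] [IsStrictOrderedRing R] {f : α → R}
    (hf : ∀ a, f a = 0 ∨ f a = 1) (hsum : ∑ a, f a ≤ 1) :
    ∃ o : Option α, ∀ a, f a = if o = some a then 1 else 0 := by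
  by_cases h : ∃ a, f a = 1
  · obtain ⟨a, ha⟩ := h
    refine ⟨some a, fun a' => ?_⟩
    rcases eq_or_ne a a' with rfl | hne
    · simpa
    · have hnonneg (b : α) : 0 ≤ f b := by rcases hf b with h | h <;> simp [h]
      have := Finset.add_le_sum (fun b _ => hnonneg b) (Finset.mem_univ a) (Finset.mem_univ a') hne
      simp only [Option.some.injEq, hne, if_false]
      linarith [hnonneg a']
  · push Not at h
    exact ⟨none, fun a => by simpa using (hf a).resolve_right (h a)⟩

namespace PackageMarket

section Packages

variable {n : ℕ}

theorem unpack_mono : Monotone (unpack (n := n)) := fun k k' h j =>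
  Finset.sum_le_sum fun S _ => by split_ifs; exacts [h S, le_rfl]

theorem feasible_of_le {Ω : Fin n → ℕ} {k k' : PackageMultiset n} (h : k ≤ k')
    (hk' : k' ∈ feasible Ω) : k ∈ feasible Ω :=
  fun j => (unpack_mono h j).trans (hk' j)

theorem price_mono {p : Package n → ℝ} (hp : ∀ S, 0 ≤ p S) : Monotone (price p) := fun _ _ h =>
  Finset.sum_le_sum fun S _ => mul_le_mul_of_nonneg_right (Nat.cast_le.2 (h S)) (hp S)

theorem price_sum {ι : Type*} [Fintype ι] (p : Package n → ℝ) (k : ι → PackageMultiset n) :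
    price p (∑ i, k i) = ∑ i, price p (k i) := by
  simp only [price, Finset.sum_apply, Nat.cast_sum, Finset.sum_mul]
  exact Finset.sum_comm

/-- The package multiset handed out by an assignment `s` of at most one package to each agent. -/
def packageCount {α : Type*} [Fintype α] (s : α → Option (Package n)) : PackageMultiset n :=
  fun S => (Finset.univ.filter fun q => s q = some S).card

theorem cast_packageCount {α : Type*} [Fintype α] (s : α → Option (Package n)) (S : Package n) :
    (packageCount s S : ℝ) = ∑ q, if s q = some S then 1 else 0 :=
  (Finset.sum_boole _ _).symm

theorem price_packageCount {α : Type*} [Fintype α] (p : Package n → ℝ)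
    (s : α → Option (Package n)) : price p (packageCount s) = ∑ q, (s q).elim 0 p := by
  simp only [price, cast_packageCount, Finset.sum_mul]
  rw [Finset.sum_comm]
  refine Finset.sum_congr rfl fun q _ => ?_
  cases s q <;> simp

end Packages

namespace CostFunctionGraph

variable {n : ℕ} (G : CostFunctionGraph n)

theorem phi_eq (Y : Package n → ℝ) (S : Package n) :
    G.phi Y S = Y S - ∑ T ∈ G.pred S, G.phi Y T := by
  rw [phi, Finset.sum_attach (G.pred S) (G.phi Y)]

theorem sum_pred₀ (f : Package n → ℝ) (S : Package n) :
    ∑ T ∈ G.pred₀ S, f T = f S + ∑ T ∈ G.pred S, f T := by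
  classical
  have hinsert : G.pred₀ S = insert S (G.pred S) := by
    ext T
    by_cases h : T = S
    · simp [pred₀, h, Relation.ReflTransGen.refl]
    · simp [pred₀, pred, h]
  rw [hinsert, Finset.sum_insert (by simp [pred])]

theorem sum_pred₀_phi (Y : Package n → ℝ) (S : Package n) :
    ∑ T ∈ G.pred₀ S, G.phi Y T = Y S := by
  rw [G.sum_pred₀, G.phi_eq Y S, sub_add_cancel]

theorem phi_unique {Y f : Package n → ℝ} (h : ∀ S, ∑ T ∈ G.pred₀ S, f T = Y S) :
    G.phi Y = f := by
  funext S
  induction S using phi.induct G with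
  | case1 S ih =>
    rw [G.phi_eq, ← h, G.sum_pred₀, Finset.sum_congr rfl fun T hT => ih ⟨T, hT⟩,
      add_sub_cancel_right]

theorem phi_eq_mulVec (Y : Package n → ℝ) : G.phi Y = G.phiMatrix.mulVec Y := by
  refine G.phi_unique fun S => ?_
  simp only [Matrix.mulVec, dotProduct]
  rw [Finset.sum_comm]
  simp [← Finset.sum_mul, phiMatrix, G.sum_pred₀_phi, Pi.single_apply]

theorem phi_mem (H : AddSubgroup ℝ) {Y : Package n → ℝ} (hY : ∀ S, Y S ∈ H) (S : Package n) :
    G.phi Y S ∈ H := by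
  induction S using phi.induct G with
  | case1 S ih =>
    rw [phi]
    exact H.sub_mem (hY S) (H.sum_mem fun T _ => ih T)

theorem phi_load (k : PackageMultiset n) : G.phi (fun S => G.load k S) = fun S => (k S : ℝ) :=
  G.phi_unique fun S => by simp [load]

theorem price_eq_sum_psi_mul_load (p : Package n → ℝ) (k : PackageMultiset n) :
    price p k = ∑ S, G.psi p S * G.load k S := by
  have h : p ⬝ᵥ G.phi (fun S => G.load k S) = G.psi p ⬝ᵥ fun S => (G.load k S : ℝ) := by
    rw [phi_eq_mulVec, Matrix.dotProduct_mulVec, psi, Matrix.mulVec_transpose]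
  rw [phi_load] at h
  simpa only [price, dotProduct, mul_comm] using h

theorem load_add (k k' : PackageMultiset n) (S : Package n) :
    G.load (k + k') S = G.load k S + G.load k' S :=
  Finset.sum_add_distrib

theorem load_single (k : PackageMultiset n) (j : Fin n) : G.load k (single j) = unpack k j := by
  have hpred : G.pred₀ (single j) = Finset.univ.filter fun T : Package n => j ∈ T.1 := by
    ext T
    simp only [pred₀, Finset.mem_filter, Finset.mem_univ, true_and]
    exact ⟨fun h => G.subset_of_path h (Finset.mem_singleton_self j), G.connected_single T j⟩
  rw [load, unpack, hpred, Finset.sum_filter]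

end CostFunctionGraph

namespace Market

variable {n L : ℕ} (M : Market n L)

section Buyers

theorem Icc_Q_subset (l : Fin L) : Finset.Icc 1 (M.Q l) ⊆ Finset.Icc 1 M.Qbar :=
  Finset.Icc_subset_Icc_right (Finset.le_sup (f := M.Q) (Finset.mem_univ l))

theorem mem_matchings {l : Fin L} {k : PackageMultiset n}
    {s : Finset.Icc 1 (M.Q l) → Option (Package n)} :
    s ∈ M.matchings l k ↔ packageCount s ≤ k := by
  simp only [matchings, Finset.mem_filter, Finset.mem_univ, true_and, packageCount, Pi.le_def]

theorem value_sub_price_le_of_isDualFeasible {b : M.Agent → Fin L → ℝ}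
    {d : Package n → M.Step → ℝ} {p : Package n → ℝ} (h : M.IsDualFeasible b d p) (l : Fin L)
    (k : PackageMultiset n) : (M.value l k : ℝ) - price p k ≤ ∑ q, b q l := by
  have hne : (M.matchings l k).Nonempty := ⟨fun _ => none, by simp [matchings]⟩
  obtain ⟨s, hs, hval⟩ := Finset.exists_mem_eq_sup _ hne
    fun s => ∑ q, (s q).elim 0 fun S => M.v l S q
  have hagent (q : Finset.Icc 1 (M.Q l)) : (((s q).elim 0 fun S => M.v l S q : ℕ) : ℝ) ≤
      b ⟨q, M.Icc_Q_subset l q.2⟩ l + (s q).elim 0 p := by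
    cases s q with
    | none => simpa using h.b_nonneg _ l
    | some S => exact h.value_le S ⟨q, M.Icc_Q_subset l q.2⟩ l
  rw [sub_le_iff_le_add]
  calc (M.value l k : ℝ)
      = ∑ q, (((s q).elim 0 fun S => M.v l S q : ℕ) : ℝ) := by rw [value, hval, Nat.cast_sum]
    _ ≤ ∑ q : Finset.Icc 1 (M.Q l), b ⟨q, M.Icc_Q_subset l q.2⟩ l + price p (packageCount s) := by
      rw [price_packageCount, ← Finset.sum_add_distrib]
      exact Finset.sum_le_sum fun q _ => hagent q
    _ ≤ ∑ q, b q l + price p k :=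
      add_le_add (sum_comp_inclusion_le (M.Icc_Q_subset l) fun q => h.b_nonneg q l)
        (price_mono h.p_nonneg (M.mem_matchings.1 hs))

theorem sum_elim_v_le_value (l : Fin L) {k : PackageMultiset n}
    {s : M.Agent → Option (Package n)} (hs : packageCount s ≤ k) :
    ∑ q, (s q).elim 0 (fun S => M.v l S q) ≤ M.value l k := by
  let e (q : Finset.Icc 1 (M.Q l)) : M.Agent := ⟨q, M.Icc_Q_subset l q.2⟩
  have he : Function.Injective e := fun q q' h => Subtype.ext (congrArg (fun a => a.1) h)
  have hmem : s ∘ e ∈ M.matchings l k := M.mem_matchings.2 <| le_trans (fun S =>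
    Finset.card_le_card_of_injOn e (by simp [Set.MapsTo]) he.injOn) hs
  have hout (q : M.Agent) (hq : q ∉ Set.range e) : (s q).elim 0 (fun S => M.v l S q) = 0 := by
    have hlt : M.Q l < q := by
      by_contra! hle
      exact hq ⟨⟨q, Finset.mem_Icc.2 ⟨(Finset.mem_Icc.1 q.2).1, hle⟩⟩, rfl⟩
    cases s q with
    | none => rfl
    | some S => exact M.v_eq_zero l S q hlt
  rw [← Fintype.sum_of_injective e he (fun q => (s (e q)).elim 0 fun S => M.v l S q) _ hout
    fun _ => rfl]
  exact Finset.le_sup (f := fun s : Finset.Icc 1 (M.Q l) → Option (Package n) =>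
    ∑ q, (s q).elim 0 fun S => M.v l S q) hmem

theorem exists_packageMultiset_le_value {x : Package n → M.Agent → ℝ} (l : Fin L)
    (hx : ∀ S q, x S q = 0 ∨ x S q = 1) (hsum : ∀ q, ∑ S, x S q ≤ 1) :
    ∃ k : PackageMultiset n, (∀ S, (k S : ℝ) = ∑ q, x S q) ∧
      ∑ S, ∑ q : M.Agent, (M.v l S q : ℝ) * x S q ≤ M.value l k := by
  choose s hs using fun q => exists_option_of_zero_or_one (hx · q) (hsum q)
  refine ⟨packageCount s, fun S => by simp only [cast_packageCount, hs], ?_⟩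
  rw [Finset.sum_comm]
  refine le_trans (le_of_eq ?_) (Nat.cast_le.2 (M.sum_elim_v_le_value l (le_refl (packageCount s))))
  rw [Nat.cast_sum]
  refine Finset.sum_congr rfl fun q _ => ?_
  simp only [hs]
  cases s q <;> simp

end Buyers

section Seller

theorem monotoneOn_Δc (S : Package n) : MonotoneOn (M.Δc S) (Set.Ici 1) :=
  fun r hr r' _ h => by
  induction r', h using Nat.le_induction with
  | base => exact le_rfl
  | succ m hm ih => exact (ih (le_trans hr hm)).trans (M.Δc_mono S m (le_trans hr hm))

theorem le_Rbar {S : Package n} {r : ℕ} (h : M.Δc S r ≠ ⊤) : r ≤ M.Rbar := by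
  obtain ⟨R, hR⟩ := M.Δc_finite_steps
  refine le_csSup ⟨R, fun r ⟨S, hS⟩ => ?_⟩ ⟨S, h⟩
  by_contra! hlt
  exact hS (hR S r hlt)

theorem sellerCost_le_of_le {k k' : PackageMultiset n} (h : k ≤ k') (hk' : k' ∈ feasible M.Ω) :
    M.sellerCost k ≤ M.sellerCost k' := by
  obtain ⟨e, rfl⟩ := exists_add_of_le h
  have he : 0 ≤ M.sellerCost e := M.cost_nonneg e (feasible_of_le le_add_self hk')
  calc M.sellerCost k ≤ M.sellerCost k + M.sellerCost e := le_add_of_nonneg_right he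
    _ ≤ M.sellerCost (k + e) := by
      simp only [sellerCost, CostFunctionGraph.cost, ← Finset.sum_add_distrib, M.G.load_add]
      exact Finset.sum_le_sum fun S _ => sum_Icc_add_sum_Icc_le (M.monotoneOn_Δc S) _ _

theorem sellerCost_ne_top_iff {k : PackageMultiset n} :
    M.sellerCost k ≠ ⊤ ↔ ∀ S, ∀ r ∈ Finset.Icc 1 (M.G.load k S), M.Δc S r ≠ ⊤ := by
  simp [sellerCost, CostFunctionGraph.cost, WithTop.sum_eq_top]

theorem feasible_of_sellerCost_ne_top {k : PackageMultiset n} (h : M.sellerCost k ≠ ⊤) :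
    k ∈ feasible M.Ω := fun j => by
  by_contra! hlt
  rw [← M.G.load_single] at hlt
  exact M.sellerCost_ne_top_iff.1 h (single j) _ (Finset.right_mem_Icc.2 (Nat.one_le_of_lt hlt))
    (M.Δc_single j _ hlt)

theorem sellerUtility_eq_sum (p : Package n → ℝ) {k : PackageMultiset n}
    (h : M.sellerCost k ≠ ⊤) :
    M.sellerUtility p k =
      ∑ S, ∑ r ∈ Finset.Icc 1 (M.G.load k S), (M.G.psi p S - M.stepCost S r) := by
  have hcost : M.sellerCost k =
      (∑ S, ∑ r ∈ Finset.Icc 1 (M.G.load k S), (M.Δc S r).untopD 0 : ℤ) := by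
    simp only [sellerCost, CostFunctionGraph.cost, WithTop.coe_sum]
    exact Finset.sum_congr rfl fun S _ => Finset.sum_congr rfl fun r hr =>
      (coe_untopD_of_ne_top (M.sellerCost_ne_top_iff.1 h S r hr)).symm
  simp only [sellerUtility, hcost, WithTop.untopD_coe, M.G.price_eq_sum_psi_mul_load, stepCost,
    Finset.sum_sub_distrib, Int.cast_sum, Finset.sum_const, Nat.card_Icc, add_tsub_cancel_right,
    nsmul_eq_mul, mul_comm]

theorem sellerUtility_le_of_isDualFeasible {b : M.Agent → Fin L → ℝ} {d : Package n → M.Step → ℝ}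
    {p : Package n → ℝ} (h : M.IsDualFeasible b d p) {k : PackageMultiset n}
    (hk : M.sellerCost k ≠ ⊤) : M.sellerUtility p k ≤ ∑ S, ∑ r, d S r := by
  rw [M.sellerUtility_eq_sum p hk]
  refine Finset.sum_le_sum fun S _ => ?_
  have hfin := M.sellerCost_ne_top_iff.1 hk S
  have hsub : Finset.Icc 1 (M.G.load k S) ⊆ Finset.Icc 1 M.Rbar := fun r hr =>
    Finset.mem_Icc.2 ⟨(Finset.mem_Icc.1 hr).1, M.le_Rbar (hfin r hr)⟩
  rw [← Finset.sum_coe_sort]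
  refine le_trans (Finset.sum_le_sum fun r _ => ?_) (sum_comp_inclusion_le hsub (h.d_nonneg S))
  have := h.neg_cost_le S ⟨r, hsub r.2⟩ (hfin r r.2)
  linarith

theorem sellerCost_le_sum_of_load_eq_card {k : PackageMultiset n} {A : Package n → Finset ℕ}
    (hA : ∀ S, ∀ r ∈ A S, 1 ≤ r) (hk : ∀ S, M.G.load k S = (A S).card) :
    M.sellerCost k ≤ ∑ S, ∑ r ∈ A S, M.Δc S r := by
  simp only [sellerCost, CostFunctionGraph.cost, hk]
  exact Finset.sum_le_sum fun S _ => sum_Icc_card_le_sum (M.monotoneOn_Δc S) (hA S)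

theorem exists_packageMultiset_eq_phiOf {y : Package n → M.Step → ℝ}
    (hy : ∀ S r, y S r = 0 ∨ y S r = 1) (hphi : ∀ S, 0 ≤ M.phiOf y S) :
    ∃ k : PackageMultiset n, ∀ S, (k S : ℝ) = M.phiOf y S := by
  have hint (S : Package n) : M.phiOf y S ∈ (Int.castAddHom ℝ).range :=
    M.G.phi_mem _ (fun T => sum_mem fun r _ => by
      rcases hy T r with h | h <;> rw [h]
      exacts [zero_mem _, ⟨1, Int.cast_one⟩]) S
  have hnat (S : Package n) : ∃ m : ℕ, (m : ℝ) = M.phiOf y S := by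
    obtain ⟨z, hz : (z : ℝ) = _⟩ := hint S
    have hz₀ : 0 ≤ z := by exact_mod_cast hz ▸ hphi S
    lift z to ℕ using hz₀
    exact ⟨z, by exact_mod_cast hz⟩
  choose k hk using hnat
  exact ⟨k, hk⟩

theorem exists_sellerCost_le_of_eq_phiOf {y : Package n → M.Step → ℝ} {k : PackageMultiset n}
    (hy : ∀ S r, y S r = 0 ∨ y S r = 1)
    (hy_top : ∀ (S : Package n) (r : M.Step), M.Δc S r = ⊤ → y S r = 0)
    (hk : ∀ S, (k S : ℝ) = M.phiOf y S) :
    ∃ c : ℤ, M.sellerCost k ≤ c ∧ (c : ℝ) = ∑ S, ∑ r : M.Step, M.stepCost S r * y S r := by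
  let A (S : Package n) : Finset M.Step := {r | y S r = 1}
  have hsum (S : Package n) (g : M.Step → ℝ) : ∑ r, g r * y S r = ∑ r ∈ A S, g r := by
    rw [Finset.sum_filter]
    exact Finset.sum_congr rfl fun r _ => by rcases hy S r with h | h <;> simp [h]
  have hload (S : Package n) :
      M.G.load k S = ((A S).map (Function.Embedding.subtype _)).card := by
    have h : (M.G.load k S : ℝ) = ∑ r, 1 * y S r := by
      simpa [CostFunctionGraph.load, hk, phiOf] using M.G.sum_pred₀_phi _ S
    rw [hsum] at h
    simpa using h
  have hfin (S : Package n) (r : M.Step) (hr : r ∈ A S) :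
      M.Δc S r = ((M.Δc S r).untopD 0 : ℤ) :=
    (coe_untopD_of_ne_top fun h => by simp [A, hy_top S r h] at hr).symm
  refine ⟨∑ S, ∑ r ∈ A S, (M.Δc S r).untopD 0, ?_, by push_cast; simp only [hsum, stepCost]⟩
  refine (M.sellerCost_le_sum_of_load_eq_card (fun S r hr => ?_) hload).trans_eq ?_
  · obtain ⟨r, -, rfl⟩ := Finset.mem_map.1 hr
    exact (Finset.mem_Icc.1 r.2).1
  · simp only [Finset.sum_map, Function.Embedding.subtype_apply, WithTop.coe_sum]
    exact Finset.sum_congr rfl fun S _ => Finset.sum_congr rfl (hfin S)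

end Seller

section Duality

open Matrix

/-- The variables of SWLP: the `x(S, q, l)` on the left and the `y(S, r)` on the right. -/
abbrev PrimalVariable : Type := (Package n × M.Agent × Fin L) ⊕ (Package n × M.Step)

/-- The constraints of SWLP other than nonnegativity: one for each agent, each package and each
step. The dual variables `b`, `p` and `d` are their multipliers. -/
abbrev PrimalConstraint : Type := (M.Agent × Fin L) ⊕ Package n ⊕ (Package n × M.Step)

/-- The vector of all variables of SWLP. -/
def primalVector (x : Package n → M.Agent → Fin L → ℝ) (y : Package n → M.Step → ℝ) :
    M.PrimalVariable → ℝ :=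
  Sum.elim (fun i => x i.1 i.2.1 i.2.2) fun i => y i.1 i.2

/-- The coefficients of the constraints of SWLP. -/
noncomputable def constraintMatrix : Matrix M.PrimalConstraint M.PrimalVariable ℝ
  | .inl (q, l), .inl (_, q', l') => if (q', l') = (q, l) then 1 else 0
  | .inl _, .inr _ => 0
  | .inr (.inl S), .inl (S', _, _) => if S' = S then 1 else 0
  | .inr (.inl S), .inr (T, _) => -M.G.phiMatrix S T
  | .inr (.inr _), .inl _ => 0
  | .inr (.inr i), .inr i' => if i' = i then 1 else 0

/-- The right-hand sides of the constraints of SWLP. A step of infinite cost gets the bound `0`,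
which together with nonnegativity says that it cannot be used. -/
noncomputable def constraintBound : M.PrimalConstraint → ℝ :=
  open Classical in
  Sum.elim (fun _ => 1) (Sum.elim 0 fun i => if M.Δc i.1 i.2 = ⊤ then 0 else 1)

/-- The coefficients of the objective function of SWLP. -/
noncomputable def objectiveVector : M.PrimalVariable → ℝ :=
  Sum.elim (fun i => M.v i.2.2 i.1 i.2.1) fun i => -M.stepCost i.1 i.2

theorem objectiveVector_dotProduct_primalVector (x : Package n → M.Agent → Fin L → ℝ)
    (y : Package n → M.Step → ℝ) :
    M.objectiveVector ⬝ᵥ M.primalVector x y = M.primalObjective x y := by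
  simp [objectiveVector, primalVector, primalObjective, dotProduct, Fintype.sum_sum_type,
    Fintype.sum_prod_type, sub_eq_add_neg]

theorem constraintMatrix_mulVec_primalVector (x : Package n → M.Agent → Fin L → ℝ)
    (y : Package n → M.Step → ℝ) :
    M.constraintMatrix *ᵥ M.primalVector x y =
      Sum.elim (fun i => ∑ S, x S i.1 i.2)
        (Sum.elim (fun S => ∑ q, ∑ l, x S q l - M.phiOf y S) fun i => y i.1 i.2) := by
  funext i
  rcases i with ⟨q, l⟩ | S | ⟨S, r⟩
  · simp [constraintMatrix, primalVector, mulVec, dotProduct, Fintype.sum_sum_type,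
      Fintype.sum_prod_type, Prod.ext_iff, ite_and]
  · simp [constraintMatrix, primalVector, mulVec, dotProduct, Fintype.sum_sum_type,
      Fintype.sum_prod_type, phiOf, CostFunctionGraph.phi_eq_mulVec, Finset.mul_sum,
      sub_eq_add_neg]
  · simp [constraintMatrix, primalVector, mulVec, dotProduct, Fintype.sum_sum_type,
      Fintype.sum_prod_type, Prod.ext_iff, ite_and]

theorem vecMul_constraintMatrix (w : M.PrimalConstraint → ℝ) :
    w ᵥ* M.constraintMatrix =
      Sum.elim (fun i => w (.inl i.2) + w (.inr (.inl i.1))) fun i =>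
        w (.inr (.inr i)) - M.G.psi (fun S => w (.inr (.inl S))) i.1 := by
  funext i
  rcases i with ⟨S, q, l⟩ | ⟨S, r⟩
  · simp [constraintMatrix, vecMul, dotProduct, Fintype.sum_sum_type, Fintype.sum_prod_type,
      Prod.ext_iff, ite_and]
  · simp [constraintMatrix, vecMul, dotProduct, Fintype.sum_sum_type, Fintype.sum_prod_type,
      Prod.ext_iff, ite_and, CostFunctionGraph.psi, mulVec, mul_comm, sub_eq_neg_add]

theorem isPrimalFeasible_iff {x : Package n → M.Agent → Fin L → ℝ}
    {y : Package n → M.Step → ℝ} :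
    M.IsPrimalFeasible x y ↔
      M.constraintMatrix *ᵥ M.primalVector x y ≤ M.constraintBound ∧ 0 ≤ M.primalVector x y := by
  rw [constraintMatrix_mulVec_primalVector]
  simp only [Pi.le_def, Sum.forall, Prod.forall, constraintBound, primalVector, Sum.elim_inl,
    Sum.elim_inr, Pi.zero_apply]
  constructor
  · intro h
    refine ⟨⟨h.agent_le_one, h.sold_le_phi, fun S r => ?_⟩, h.x_nonneg, h.y_nonneg⟩
    split_ifs with hr
    exacts [(h.y_eq_zero S r hr).le, h.y_le_one S r]
  · rintro ⟨⟨hagent, hsold, hy⟩, hx₀, hy₀⟩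
    refine ⟨hagent, hsold, fun S r => (hy S r).trans ?_, hx₀, hy₀, fun S r hr =>
      le_antisymm ((hy S r).trans_eq (if_pos hr)) (hy₀ S r)⟩
    split_ifs <;> norm_num

theorem IsPrimalOptimal.isMaxOn {M : Market n L} {x : Package n → M.Agent → Fin L → ℝ}
    {y : Package n → M.Step → ℝ} (h : M.IsPrimalOptimal x y) :
    IsMaxOn (M.objectiveVector ⬝ᵥ ·) {z | M.constraintMatrix *ᵥ z ≤ M.constraintBound ∧ 0 ≤ z}
      (M.primalVector x y) := fun z hz => by
  have hsplit : z = M.primalVector (fun S q l => z (.inl (S, q, l))) fun S r => z (.inr (S, r)) :=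
    (Sum.elim_comp_inl_inr z).symm
  rw [hsplit] at hz ⊢
  simpa only [Set.mem_ofPred_eq, objectiveVector_dotProduct_primalVector] using
    h.2 _ _ (M.isPrimalFeasible_iff.2 hz)

theorem IsPrimalOptimal.exists_isDualFeasible {M : Market n L}
    {x : Package n → M.Agent → Fin L → ℝ} {y : Package n → M.Step → ℝ}
    (h : M.IsPrimalOptimal x y) :
    ∃ b d p, M.IsDualFeasible b d p ∧ M.dualObjective b d = M.primalObjective x y := by
  classical
  obtain ⟨w, hw, hc, hval⟩ := LinearProgramming.exists_dual_of_isMaxOn M.constraintMatrix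
    M.constraintBound M.objectiveVector (M.isPrimalFeasible_iff.1 h.1) h.isMaxOn
  rw [vecMul_constraintMatrix] at hc
  -- The multiplier of an unusable step does not matter, but it must not count in the objective.
  refine ⟨fun q l => w (.inl (q, l)),
    fun S r => if M.Δc S r = ⊤ then 0 else w (.inr (.inr (S, r))), fun S => w (.inr (.inl S)),
    ⟨fun S q l => hc (.inl (S, q, l)), fun S r hr => ?_, fun q l => hw _, fun S r => ?_,
      fun S => hw _⟩, ?_⟩
  · rw [if_neg hr]
    exact hc (.inr (S, r))
  · split_ifs
    exacts [le_rfl, hw _]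
  · rw [← objectiveVector_dotProduct_primalVector, ← hval]
    simp [dotProduct, constraintBound, dualObjective, Fintype.sum_sum_type, Fintype.sum_prod_type]

end Duality

section Equilibrium

theorem mem_supply_and_mem_demand {b : M.Agent → Fin L → ℝ} {d : Package n → M.Step → ℝ}
    {p : Package n → ℝ} (h : M.IsDualFeasible b d p) {π : Fin L → PackageMultiset n}
    {k : PackageMultiset n} {c : ℤ} (hπk : ∑ l, π l ≤ k) (hc : M.sellerCost k ≤ c)
    (hW : M.dualObjective b d ≤ ∑ l, (M.value l (π l) : ℝ) - c) :
    k ∈ M.supply p ∧ ∀ l, π l ∈ M.demand l p := by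
  have hfin : M.sellerCost k ≠ ⊤ := ne_top_of_le_ne_top WithTop.coe_ne_top hc
  have hk : k ∈ feasible M.Ω := M.feasible_of_sellerCost_ne_top hfin
  have hbuyer (l : Fin L) := M.value_sub_price_le_of_isDualFeasible h l (π l)
  have hseller := M.sellerUtility_le_of_isDualFeasible h hfin
  have htotal : ∑ l, ∑ q, b q l + ∑ S, ∑ r, d S r ≤
      ∑ l, ((M.value l (π l) : ℝ) - price p (π l)) + M.sellerUtility p k := by
    have hcost : (((M.sellerCost k).untopD 0 : ℤ) : ℝ) ≤ c :=
      Int.cast_le.2 (WithTop.untopD_le hc)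
    have hprice := price_mono h.p_nonneg hπk
    rw [price_sum] at hprice
    rw [dualObjective, Finset.sum_comm] at hW
    rw [Finset.sum_sub_distrib, sellerUtility]
    linarith
  have hbuyers := Finset.sum_le_sum fun l (_ : l ∈ Finset.univ) => hbuyer l
  have hbuyer_eq : ∀ l, (M.value l (π l) : ℝ) - price p (π l) = ∑ q, b q l := by
    have hsum : ∑ l, ((M.value l (π l) : ℝ) - price p (π l)) = ∑ l, ∑ q, b q l := by linarith
    exact fun l => (Finset.sum_eq_sum_iff_of_le fun l _ => hbuyer l).1 hsum l (Finset.mem_univ l)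
  refine ⟨⟨⟨hk, hfin⟩, fun k' _ hk' => ?_⟩, fun l => ⟨?_, fun k' _ => ?_⟩⟩
  · linarith [M.sellerUtility_le_of_isDualFeasible h hk']
  · exact feasible_of_le
      ((Finset.single_le_sum_of_canonicallyOrdered (Finset.mem_univ l)).trans hπk) hk
  · exact (M.value_sub_price_le_of_isDualFeasible h l k').trans_eq (hbuyer_eq l).symm

theorem exists_allocation_of_zero_or_one {x : Package n → M.Agent → Fin L → ℝ}
    {y : Package n → M.Step → ℝ} (h : M.IsPrimalFeasible x y)
    (hx : ∀ S q l, x S q l = 0 ∨ x S q l = 1) (hy : ∀ S r, y S r = 0 ∨ y S r = 1) :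
    ∃ (π : Fin L → PackageMultiset n) (k : PackageMultiset n) (c : ℤ),
      (∀ l S, (π l S : ℝ) = ∑ q, x S q l) ∧ (∀ S, (k S : ℝ) = M.phiOf y S) ∧
      ∑ l, π l ≤ k ∧ M.sellerCost k ≤ c ∧
      M.primalObjective x y ≤ ∑ l, (M.value l (π l) : ℝ) - c := by
  choose π hπ hvalue using fun l => M.exists_packageMultiset_le_value l (hx · · l)
    (h.agent_le_one · l)
  have hsold (S : Package n) : ∑ q, ∑ l, x S q l ≤ M.phiOf y S := sub_nonpos.1 (h.sold_le_phi S)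
  obtain ⟨k, hk⟩ := M.exists_packageMultiset_eq_phiOf hy fun S =>
    (Finset.sum_nonneg fun q _ => Finset.sum_nonneg fun l _ => h.x_nonneg S q l).trans (hsold S)
  obtain ⟨c, hc, hcsum⟩ := M.exists_sellerCost_le_of_eq_phiOf hy h.y_eq_zero hk
  refine ⟨π, k, c, hπ, hk, fun S => ?_, hc, ?_⟩
  · have hle : ∑ l, (π l S : ℝ) ≤ k S := by
      simp only [hπ, hk]
      exact Finset.sum_comm.trans_le (hsold S)
    rw [Finset.sum_apply]
    exact_mod_cast hle
  · have hswap : ∑ S, ∑ q : M.Agent, ∑ l, (M.v l S q : ℝ) * x S q l =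
        ∑ l, ∑ S, ∑ q : M.Agent, (M.v l S q : ℝ) * x S q l := by
      rw [Finset.sum_comm (s := (Finset.univ : Finset (Fin L)))]
      exact Finset.sum_congr rfl fun S _ => Finset.sum_comm
    rw [primalObjective, hcsum, hswap]
    exact sub_le_sub_right (Finset.sum_le_sum fun l _ => hvalue l) _

end Equilibrium

end Market

end PackageMarket

theorem mainTheorem4 {n L : ℕ} (M : PackageMarket.Market n L)
    (x : PackageMarket.Package n → M.Agent → Fin L → ℝ)
    (y : PackageMarket.Package n → M.Step → ℝ)
    (hxy : M.IsPrimalOptimal x y)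
    (hx : ∀ S q l, x S q l = 0 ∨ x S q l = 1)
    (hy : ∀ S r, y S r = 0 ∨ y S r = 1)
    (b : M.Agent → Fin L → ℝ) (d : PackageMarket.Package n → M.Step → ℝ)
    (p : PackageMarket.Package n → ℝ)
    (hbdp : M.IsDualOptimal b d p) :
    ∃ (π : Fin L → PackageMarket.PackageMultiset n) (k : PackageMarket.PackageMultiset n),
      (∀ l S, (π l S : ℝ) = ∑ q, x S q l) ∧
      (∀ S, (k S : ℝ) = M.phiOf y S) ∧
      M.IsWalrasianEquilibrium p π ∧
      k ∈ M.supply p := by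
  obtain ⟨b', d', p', hfeas', hstrong⟩ := hxy.exists_isDualFeasible
  have hW : M.dualObjective b d ≤ M.primalObjective x y := hstrong ▸ hbdp.2 b' d' p' hfeas'
  obtain ⟨π, k, c, hπ, hk, hπk, hc, hvalue⟩ := M.exists_allocation_of_zero_or_one hxy.1 hx hy
  obtain ⟨hk_supply, hdemand⟩ := M.mem_supply_and_mem_demand hbdp.1 hπk hc (hW.trans hvalue)
  have hcost : M.sellerCost (∑ l, π l) ≤ c :=
    (M.sellerCost_le_of_le hπk hk_supply.1.1).trans hc
  have hπ_supply := (M.mem_supply_and_mem_demand hbdp.1 le_rfl hcost (hW.trans hvalue)).1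
  exact ⟨π, k, hπ, hk, ⟨hπ_supply.1.1, hπ_supply, hdemand⟩, hk_supply⟩
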